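/- Let $A$ be a $C^*$-algebra and let $\mathcal K$ be the compact operators on a separable infinite-dimensional Hilbert space; view $A$ inside $A\otimes\mathcal K$ as $A\otimes e_{1,1}$. Let $\mathrm{Ped}(\cdot)$ denote the Pedersen ideal (the smallest dense two-sided ideal), and let $\widetilde{QT}(A)$ be the cone of all (finite) 2-quasitraces on $\mathrm{Ped}(A\otimes\mathcal K)$, with the topology of pointwise convergence on $\mathrm{Ped}(A\otimes\mathcal K)$. For $\tau\in\widetilde{QT}(A)$ and $a\in(A\otimes\mathcal K)_+$ put $d_\tau(a)=\lim_{\varepsilon\to0}\tau(f_\varepsilon(a))$, where $f_\varepsilon$ is $0$ on $[0,\varepsilon/2]$, $1$ on $[\varepsilon,\infty)$ and linear in between; let $\mathrm{Her}(a)=\overline{a(A\otimes\mathcal K)a}$. For $S\subset\widetilde{QT}(A)$ and $a\in\mathrm{Ped}(A\otimes\mathcal K)_+$ put $$\omega(a)|_S=\inf\Big\{\sup_{\tau\in S}\big(d_\tau(a)-\tau(c)\big): c\in\mathrm{Her}(a),\ 0\le c\le1\Big\},$$ $$\Omega^N(a)|_S=\inf\Big\{\sup_n\|a-b_n\| : \{b_n\}\text{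 a bounded sequence in }\mathrm{Her}(a)_+\cap\mathrm{Ped}(A\otimes\mathcal K),\ \lim_{n\to\infty}\omega(b_n)|_S=0\Big\}.$$ Call $S$ a compact base if $S\subset\widetilde{QT}(A)\setminus\{0\}$ is compact and convex and $\mathbb R_+\cdot S=\widetilde{QT}(A)$. The algebra $A$ has norm approximate oscillation zero if $\widetilde{QT}(A)$ has a compact base and $\Omega^N(a)|_S=0$ for every compact base $S$ and every $a\in\mathrm{Ped}(A\otimes\mathcal K)_+$. **Theorem.** Let $b\in\mathrm{Ped}(A)_+\setminus\{0\}$ be such that $T_b=\{\tau\in\widetilde{QT}(A):\tau(b)=1\}$ is a compact base (which is automatic if $A$ is simple and $\widetilde{QT}(A)\neq\{0\}$). If the set $\partial_e(T_b)$ of extreme points of $T_b$ is countable, then $$\Omega^N(a)|_{T_b}=0\quad\text{for all } a\in\mathrm{Ped}(A\otimes\mathcal K)_+ .$$ In particular, $A$ has norm approximate oscillation zero. -/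

import Mathlib

open scoped ENNReal Topology

noncomputable section

namespace QuasiTr

universe u

/-! ### The stabilization `A ⊗ 𝒦` -/

section Stabilization

open scoped ComplexOrder

variable (A : Type u) [NonUnitalCStarAlgebra A] [PartialOrder A] [StarOrderedRing A]

/-- The Hilbert space of the universal representation of `A`: the Hilbert sum of the GNS spaces of
all positive linear functionals on `A`. -/
abbrev UnivSpace : Type u := lp (fun f : A →ₚ[ℂ] ℂ => f.GNS) 2

variable {A} in
/-- The universal representation of `A`, which is faithful by the Gelfand–Naimark theorem:
`a` acts on the summand of `f` through the GNS representation of `f`. -/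
def univRep (a : A) : UnivSpace A →L[ℂ] UnivSpace A :=
  lp.mapCLM 2 (fun f : A →ₚ[ℂ] ℂ => f.gnsNonUnitalStarAlgHom a) (norm_nonneg a)
    (fun f => NonUnitalStarAlgHom.norm_apply_le f.gnsNonUnitalStarAlgHom a)

/-- The Hilbert space `ℓ²(ℕ) ⊗ H`, where `H` is the space of the universal representation. -/
abbrev StabSpace : Type u := lp (fun _ : ℕ => UnivSpace A) 2

/-- The isometry of `H` onto the `i`-th summand of `ℓ²(ℕ) ⊗ H`. -/
def stabIncl (i : ℕ) : UnivSpace A →L[ℂ] StabSpace A :=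
  lp.singleContinuousLinearMap ℂ (fun _ : ℕ => UnivSpace A) 2 i

variable {A} in
/-- The operator `a ⊗ e i j` on `ℓ²(ℕ) ⊗ H`, where the `e i j` are the matrix units of `ℓ²(ℕ)`. -/
def tensorUnit (a : A) (i j : ℕ) : StabSpace A →L[ℂ] StabSpace A :=
  stabIncl A i ∘L univRep a ∘L ContinuousLinearMap.adjoint (stabIncl A j)

/-- `A ⊗ 𝒦` as a concrete C⋆-algebra of operators: the C⋆-algebra generated by all `a ⊗ e i j`. -/
def stabSubalgebra : NonUnitalStarSubalgebra ℂ (StabSpace A →L[ℂ] StabSpace A) :=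
  (NonUnitalStarAlgebra.adjoin ℂ
    {T | ∃ (a : A) (i j : ℕ), T = tensorUnit a i j}).topologicalClosure

/-- The C⋆-algebra `A ⊗ 𝒦`, `𝒦` being the compact operators on `ℓ²(ℕ)`. -/
def Stab : Type u := stabSubalgebra A

instance : NonUnitalCStarAlgebra (Stab A) :=
  NonUnitalStarSubalgebra.nonUnitalCStarAlgebra (stabSubalgebra A)
    (h_closed := NonUnitalStarSubalgebra.isClosed_topologicalClosure _)

/-- The usual order of a C⋆-algebra: `x ≤ y` iff `y - x` is positive. -/
instance : PartialOrder (Stab A) := CStarAlgebra.spectralOrder (Stab A)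

instance : StarOrderedRing (Stab A) := CStarAlgebra.spectralOrderedRing (Stab A)

variable {A} in
/-- The embedding `a ↦ a ⊗ e 0 0` of `A` into `A ⊗ 𝒦`, through which `A` is viewed as a
subalgebra of `A ⊗ 𝒦`. -/
def corner (a : A) : Stab A :=
  ⟨tensorUnit a 0 0, NonUnitalStarSubalgebra.le_topologicalClosure _
    (NonUnitalStarAlgebra.subset_adjoin ℂ _ ⟨a, 0, 0, rfl⟩)⟩

end Stabilization

/-! ### Pedersen ideal, hereditary subalgebras, quasitraces -/

section General

variable (B : Type u) [NonUnitalCStarAlgebra B]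

/-- The Pedersen ideal: the smallest dense two-sided ideal, i.e. the intersection of all of them. -/
def Ped : TwoSidedIdeal B := sInf {I : TwoSidedIdeal B | Dense (I : Set B)}

variable {B}

/-- The hereditary C⋆-subalgebra `closure (a B a)` generated by a positive element `a`. -/
def Her (a : B) : Set B := closure (Set.range fun x : B => a * x * a)

/-- A quasitrace on `Ped B`. It is represented by its extension by `0` to all of `B`, which makes
pointwise convergence on `B` the same as pointwise convergence on `Ped B`. -/
structure IsQuasitrace (τ : B → ℂ) : Prop where
  /-- convention: `τ` is extended by `0` outside its domain -/
  eq_zero_of_notMem : ∀ x, x ∉ Ped B → τ x = 0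
  tracial : ∀ x ∈ Ped B, τ (star x * x) = τ (x * star x)
  nonneg : ∀ x ∈ Ped B, 0 ≤ (τ (star x * x)).re ∧ (τ (star x * x)).im = 0
  map_add_I : ∀ x ∈ Ped B, ∀ y ∈ Ped B, IsSelfAdjoint x → IsSelfAdjoint y →
    τ (x + Complex.I • y) = τ x + Complex.I * τ y
  /-- `τ` is linear on every commutative C⋆-subalgebra of `B` that is contained in `Ped B` -/
  linear_on_comm : ∀ C : NonUnitalStarSubalgebra ℂ B, IsClosed (C : Set B) →
    (C : Set B) ⊆ (Ped B : Set B) → (∀ x ∈ C, ∀ y ∈ C, x * y = y * x) →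
    ∀ (z : ℂ), ∀ x ∈ C, ∀ y ∈ C, τ (z • x + y) = z * τ x + τ y

/-- A 2-quasitrace on `Ped B`: a quasitrace that extends to a quasitrace on `M₂(B)`, where
`x : B` is identified with the matrix that has the entry `x` in the upper left corner. -/
def IsTwoQuasitrace [PartialOrder B] [StarOrderedRing B] (τ : B → ℂ) : Prop :=
  IsQuasitrace τ ∧ ∃ σ : CStarMatrix (Fin 2) (Fin 2) B → ℂ, IsQuasitrace σ ∧
    ∀ x ∈ Ped B, σ (CStarMatrix.ofMatrix (Matrix.single 0 0 x)) = τ x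

/-- The function `f_ε`: it is `0` up to `ε / 2`, `1` from `ε` on, and linear in between. -/
def cutoff (ε : ℝ) (t : ℝ) : ℝ := min 1 (max 0 (2 * t / ε - 1))

/-- The dimension function `d_τ(a) = lim_{ε → 0} τ(f_ε(a))` for `a ≥ 0`. As `f_ε(a)` increases when
`ε` decreases, the limit is a supremum. -/
def dimFun (τ : B → ℂ) (a : B) : ℝ≥0∞ :=
  ⨆ (ε : ℝ) (_ : 0 < ε), ENNReal.ofReal (τ (cfcₙ (cutoff ε) a)).re

/-- The tracial oscillation of `a` on `S`,
`ω(a)|_S = inf {sup {d_τ(a) - τ(c) : τ ∈ S} : c ∈ Her(a), 0 ≤ c ≤ 1}`.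
As `0 ≤ τ(c) ≤ d_τ(a)` for these `c`, the differences are taken in `[0, ∞]`. -/
def osc [PartialOrder B] (S : Set (B → ℂ)) (a : B) : ℝ≥0∞ :=
  ⨅ (c : B) (_ : c ∈ Her a ∧ 0 ≤ c ∧ ‖c‖ ≤ 1),
    ⨆ τ ∈ S, (dimFun τ a - ENNReal.ofReal (τ c).re)

/-- The norm approximate oscillation `Ω^N(a)|_S`: the infimum of the norms `‖a - {b n}‖` in the
algebra of bounded sequences, over all bounded sequences of positive elements `b n ∈ Her(a)`
(in the Pedersen ideal) with `ω(b n)|_S → 0`. -/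
def normApproxOsc [PartialOrder B] (S : Set (B → ℂ)) (a : B) : ℝ≥0∞ :=
  ⨅ (b : ℕ → B) (_ : (∀ n, b n ∈ Her a ∧ b n ∈ Ped B ∧ 0 ≤ b n) ∧ (∃ M : ℝ, ∀ n, ‖b n‖ ≤ M) ∧
      Filter.Tendsto (fun n => osc S (b n)) Filter.atTop (𝓝 0)),
    ⨆ n, ‖a - b n‖ₑ

end General

/-! ### The cone of densely defined 2-quasitraces on `A ⊗ 𝒦` -/

section Cone

variable (A : Type u) [NonUnitalCStarAlgebra A] [PartialOrder A] [StarOrderedRing A]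

/-- The cone of densely defined 2-quasitraces on `A ⊗ 𝒦`. Its topology of pointwise convergence on
`Ped (A ⊗ 𝒦)` and its linear structure are those of the function space `Stab A → ℂ`. -/
def QTcone : Set (Stab A → ℂ) := {τ | IsTwoQuasitrace τ}

variable {A} in
/-- `T_b`: the 2-quasitraces that take the value `1` at `b`. -/
def Tslice (b : A) : Set (Stab A → ℂ) := {τ | τ ∈ QTcone A ∧ τ (corner b) = 1}

/-- `S` is a compact convex set of nonzero 2-quasitraces with `ℝ₊ · S` the whole cone. -/
structure IsCompactBase (S : Set (Stab A → ℂ)) : Prop where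
  subset : S ⊆ QTcone A \ {0}
  compact : IsCompact S
  convex : Convex ℝ S
  spans : ∀ τ ∈ QTcone A, ∃ r : ℝ, 0 ≤ r ∧ ∃ s ∈ S, τ = r • s

/-- `A` has norm approximate oscillation zero relative to `S`. -/
def NormApproxOscZeroOn (S : Set (Stab A → ℂ)) : Prop :=
  ∀ a : Stab A, a ∈ Ped (Stab A) → 0 ≤ a → normApproxOsc S a = 0

/-- `A` has norm approximate oscillation zero: the cone of 2-quasitraces has a compact base, and
`A` has norm approximate oscillation zero relative to every compact base. -/
def NormApproxOscZero : Prop :=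
  (∃ S, IsCompactBase A S) ∧ ∀ S, IsCompactBase A S → NormApproxOscZeroOn A S

end Cone

end QuasiTr

end

open scoped ENNReal Topology

namespace QuasiTr

universe u

/-! For `a ≥ 0`, a quasitrace is linear on the functions of `a` vanishing near `0`, so it acts there
like a measure on the spectrum of `a`, of finite mass on each `[t, ∞)` with `t > 0`. Each such
measure has at most countably many atoms, so countably many extreme points leave arbitrarily small
`t` that are an atom for none of them. Tents shrinking to the point `t` then have mass tending to
`0` at every extreme point, and a Dini-type argument on faces
(`exists_forall_lt_of_tendsto_extremePoints`) makes this uniform on `T_b`.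

Let `e = (a - t)₊`. Cutoffs of `e` at different heights differ only next to `t`, where a tent
dominates the difference. One cutoff of `e` therefore nearly attains `d_τ(e)` uniformly in `τ`
(`exists_dimFun_le`), so `e` has oscillation zero, while `‖a - e‖ ≤ t`. Any other compact base
consists of bounded multiples of members of `T_b`, which only rescales the error. -/

open Filter

/-! ### Functional calculus, the Pedersen ideal and quasitraces -/

section Algebra

variable {B : Type u} [NonUnitalCStarAlgebra B]

/-- Elements with a one-sided local unit of the form `h * a` lie in the Pedersen ideal. -/
theorem mem_Ped_of_mul_mul_eq {a h x : B} (hx : h * a * x = x) : x ∈ Ped B := by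
  rw [Ped, TwoSidedIdeal.mem_sInf]
  intro I hI
  obtain ⟨y, hyI, hy⟩ : ∃ y ∈ (I : Set B), ‖a - y‖ < 1 / (‖h‖ + 1) := by
    obtain ⟨y, hyI, hy⟩ := Metric.dense_iff.1 hI a (1 / (‖h‖ + 1)) (by positivity)
    refine ⟨y, hy, ?_⟩
    rwa [Metric.mem_ball, dist_comm, dist_eq_norm] at hyI
  -- Since `h a x = x`, we have `(1 - k) x = h y x` with `‖k‖ < 1`. Inverting `1 - k` in the
  -- unitization exhibits `x` as a multiple of `y ∈ I`.
  set k : B := h * (a - y) with hk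
  have hk1 : ‖(k : Unitization ℂ B)‖ < 1 := by
    rw [Unitization.norm_inr]
    calc ‖k‖ ≤ ‖h‖ * ‖a - y‖ := norm_mul_le _ _
      _ ≤ ‖h‖ * (1 / (‖h‖ + 1)) := by gcongr
      _ < 1 := by
        rw [mul_one_div, div_lt_one (by positivity)]
        linarith
  set w := (Units.oneSub (k : Unitization ℂ B) hk1)⁻¹ with hw
  have h1 : (x : Unitization ℂ B) = (w : Unitization ℂ B) * ((h * y * x : B) : Unitization ℂ B) := by
    rw [hw, Units.eq_inv_mul_iff_mul_eq, Units.val_oneSub, sub_mul, one_mul,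
      ← Unitization.inr_mul, ← Unitization.inr_sub]
    congr 1
    rw [hk, mul_sub, sub_mul, hx]
    abel
  have h2 : x = ((w : Unitization ℂ B).fst • h) * y * x + (w : Unitization ℂ B).snd * (h * y * x) := by
    have := congrArg (fun z => z.snd) h1
    simpa [smul_mul_assoc] using this
  rw [h2]
  have h3 : ∀ c : B, c * y * x ∈ I := fun c => I.mul_mem_right _ _ (I.mul_mem_left _ _ hyI)
  exact I.add_mem (h3 _) (I.mul_mem_left _ _ (h3 _))

/-- A continuous function vanishing on `(-∞, t]`. -/
structure VanishesBelow (t : ℝ) (f : ℝ → ℝ) : Prop where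
  cont : Continuous f
  zero : ∀ s ≤ t, f s = 0

/-- A continuous function equal to `1 / s` for `s ≥ t`, and vanishing at `0`. -/
noncomputable def locInv (t s : ℝ) : ℝ := s / (max s t) ^ 2

theorem continuous_locInv {t : ℝ} (ht : 0 < t) : Continuous (locInv t) := by
  unfold locInv
  refine continuous_id.div (by fun_prop) fun s => ?_
  have : 0 < max s t := lt_max_of_lt_right ht
  positivity

theorem locInv_zero (t : ℝ) : locInv t 0 = 0 := by simp [locInv]

theorem VanishesBelow.locInv_mul {t : ℝ} (ht : 0 < t) {f : ℝ → ℝ} (hf : VanishesBelow t f)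
    (s : ℝ) : locInv t s * s * f s = f s := by
  rcases le_or_gt s t with h | h
  · simp [hf.zero s h]
  · have : s ≠ 0 := by linarith
    rw [locInv, max_eq_left h.le]
    field_simp

theorem VanishesBelow.apply_zero {t : ℝ} (ht : 0 < t) {f : ℝ → ℝ} (hf : VanishesBelow t f) :
    f 0 = 0 := hf.zero 0 ht.le

theorem VanishesBelow.cfcₙ_eq {t : ℝ} (ht : 0 < t) {f : ℝ → ℝ} (hf : VanishesBelow t f)
    {a : B} (ha : IsSelfAdjoint a) :
    cfcₙ (locInv t) a * a * cfcₙ f a = cfcₙ f a := by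
  have h0 := hf.apply_zero ht
  have h1 := hf.cont
  have h2 := continuous_locInv ht
  have h3 := locInv_zero t
  conv_lhs =>
    enter [1, 2]
    rw [← cfcₙ_id ℝ a]
  rw [← cfcₙ_mul _ _ a h2.continuousOn h3 continuousOn_id rfl,
    ← cfcₙ_mul (fun s => locInv t s * id s) _ a (h2.mul continuous_id).continuousOn (by simp) h1.continuousOn h0]
  congr 1
  ext s
  exact hf.locInv_mul ht s

theorem VanishesBelow.cfcₙ_mem_Ped {t : ℝ} (ht : 0 < t) {f : ℝ → ℝ} (hf : VanishesBelow t f)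
    {a : B} (ha : IsSelfAdjoint a) : cfcₙ f a ∈ Ped B :=
  mem_Ped_of_mul_mul_eq (hf.cfcₙ_eq ht ha)

/-- Factor `f(s) = s · (f(s) / s²) · s`, with `locInv t` replacing `1 / s` on the support of `f`; no
closure is needed. -/
theorem VanishesBelow.cfcₙ_mem_Her {t : ℝ} (ht : 0 < t) {f : ℝ → ℝ} (hf : VanishesBelow t f)
    {a : B} (ha : IsSelfAdjoint a) : cfcₙ f a ∈ Her a := by
  have h0 := hf.apply_zero ht
  have h1 := hf.cont
  have h2 := continuous_locInv ht
  have h3 := locInv_zero t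
  refine subset_closure ⟨cfcₙ (fun s => locInv t s * locInv t s * f s) a, ?_⟩
  have key : cfcₙ (fun s => s * (locInv t s * locInv t s * f s) * s) a = cfcₙ f a := by
    congr 1
    ext s
    have := hf.locInv_mul ht s
    calc _ = locInv t s * s * (locInv t s * s * f s) := by ring
      _ = f s := by rw [this, this]
  rw [← key, cfcₙ_mul (fun s => s * (locInv t s * locInv t s * f s)) (fun s => s) a
      (by fun_prop) (by simp) (by fun_prop) rfl,
    cfcₙ_mul (fun s => s) (fun s => locInv t s * locInv t s * f s) a
      (by fun_prop) rfl (by fun_prop) (by simp [h0]), cfcₙ_id' ℝ a]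

/-- The closed commutative subalgebra of the elements of `C⋆(a)` that are fixed by `e`. -/
def fixedSubalgebra (a e : B) : NonUnitalStarSubalgebra ℂ B where
  carrier := {x | x ∈ NonUnitalStarAlgebra.elemental ℂ a ∧ e * x = x ∧ e * star x = star x}
  add_mem' := by
    rintro x y ⟨hx, hx1, hx2⟩ ⟨hy, hy1, hy2⟩
    exact ⟨add_mem hx hy, by rw [mul_add, hx1, hy1], by rw [star_add, mul_add, hx2, hy2]⟩
  zero_mem' := ⟨zero_mem _, by simp, by simp⟩
  mul_mem' := by
    rintro x y ⟨hx, hx1, hx2⟩ ⟨hy, hy1, hy2⟩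
    exact ⟨mul_mem hx hy, by rw [← mul_assoc, hx1], by rw [star_mul, ← mul_assoc, hy2]⟩
  smul_mem' := by
    rintro c x ⟨hx, hx1, hx2⟩
    exact ⟨SMulMemClass.smul_mem c hx, by rw [mul_smul_comm, hx1],
      by rw [star_smul, mul_smul_comm, hx2]⟩
  star_mem' := by
    rintro x ⟨hx, hx1, hx2⟩
    exact ⟨star_mem hx, hx2, by rwa [star_star]⟩

theorem isClosed_fixedSubalgebra (a e : B) :
    IsClosed (fixedSubalgebra a e : Set B) :=
  (NonUnitalStarAlgebra.elemental.isClosed ℂ a).inter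
    ((isClosed_eq (by fun_prop) (by fun_prop)).inter (isClosed_eq (by fun_prop) (by fun_prop)))

theorem cfcₙ_real_mem_elemental {a : B} (ha : IsSelfAdjoint a) (f : ℝ → ℝ) :
    cfcₙ f a ∈ NonUnitalStarAlgebra.elemental ℂ a := by
  rw [cfcₙ_real_eq_complex f ha]
  exact cfcₙ_mem_elemental _ _

theorem commute_of_mem_elemental {a x y : B} (ha : IsStarNormal a)
    (hx : x ∈ NonUnitalStarAlgebra.elemental ℂ a) (hy : y ∈ NonUnitalStarAlgebra.elemental ℂ a) :
    x * y = y * x := by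
  have hx' : x ∈ (NonUnitalStarAlgebra.elemental ℂ a : Set B) := hx
  have hy' : y ∈ (NonUnitalStarAlgebra.elemental ℂ a : Set B) := hy
  rw [← range_cfcₙ ℂ ha] at hx' hy'
  obtain ⟨f, rfl⟩ := hx'
  obtain ⟨g, rfl⟩ := hy'
  exact cfcₙ_commute_cfcₙ f g a

/-- A quasitrace is additive on the functions of `a` that vanish near `0`. -/
theorem IsQuasitrace.map_cfcₙ_add {τ : B → ℂ} (hτ : IsQuasitrace τ) {a : B} (ha : IsSelfAdjoint a)
    {t : ℝ} (ht : 0 < t) {f g : ℝ → ℝ} (hf : VanishesBelow t f) (hg : VanishesBelow t g) :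
    τ (cfcₙ (fun s => f s + g s) a) = τ (cfcₙ f a) + τ (cfcₙ g a) := by
  have hn : IsStarNormal a := ha.isStarNormal
  have hmem : ∀ {f : ℝ → ℝ}, VanishesBelow t f → cfcₙ f a ∈ fixedSubalgebra a (cfcₙ (locInv t) a * a) := by
    intro f hf
    have h : star (cfcₙ f a) = cfcₙ f a := (cfcₙ_predicate f a : IsSelfAdjoint _)
    have h' := hf.cfcₙ_eq ht ha
    exact ⟨cfcₙ_real_mem_elemental ha f, h', by rw [h, h']⟩
  rw [cfcₙ_add (a := a) (f := f) (g := g) (hf := hf.cont.continuousOn) (hf0 := hf.apply_zero ht)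
    (hg := hg.cont.continuousOn) (hg0 := hg.apply_zero ht)]
  -- Linearity is only available on closed commutative subalgebras inside the Pedersen ideal. All of
  -- `C⋆(a)` may fail to lie there, but the elements with this common local unit do.
  have := hτ.linear_on_comm (fixedSubalgebra a (cfcₙ (locInv t) a * a)) (isClosed_fixedSubalgebra a (cfcₙ (locInv t) a * a))
    (fun x hx => mem_Ped_of_mul_mul_eq hx.2.1)
    (fun x hx y hy => commute_of_mem_elemental hn hx.1 hy.1) 1 _ (hmem hf) _ (hmem hg)
  simpa using this

/-- The square root `√f` vanishes below `t` too, so `f(a)` is a square of a self-adjoint element of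
the Pedersen ideal. -/
theorem IsQuasitrace.map_cfcₙ_nonneg {τ : B → ℂ} (hτ : IsQuasitrace τ) {a : B}
    (ha : IsSelfAdjoint a) {t : ℝ} (ht : 0 < t) {f : ℝ → ℝ} (hf : VanishesBelow t f)
    (h0 : ∀ s, 0 ≤ f s) : 0 ≤ (τ (cfcₙ f a)).re := by
  have hg : VanishesBelow t (fun s => √(f s)) :=
    ⟨hf.cont.sqrt, fun s hs => by simp [hf.zero s hs]⟩
  have := (hτ.nonneg _ (hg.cfcₙ_mem_Ped ht ha)).1
  rwa [(cfcₙ_predicate _ a : IsSelfAdjoint (cfcₙ (fun s => √(f s)) a)).star_eq,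
    ← cfcₙ_mul _ _ a hg.cont.continuousOn (hg.apply_zero ht) hg.cont.continuousOn
      (hg.apply_zero ht), funext fun s => Real.mul_self_sqrt (h0 s)] at this

theorem IsQuasitrace.map_cfcₙ_mono {τ : B → ℂ} (hτ : IsQuasitrace τ) {a : B}
    (ha : IsSelfAdjoint a) {t : ℝ} (ht : 0 < t) {f g : ℝ → ℝ} (hf : VanishesBelow t f)
    (hg : VanishesBelow t g) (h : ∀ s, f s ≤ g s) : (τ (cfcₙ f a)).re ≤ (τ (cfcₙ g a)).re := by
  have hd : VanishesBelow t (fun s => g s - f s) :=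
    ⟨hg.cont.sub hf.cont, fun s hs => by simp [hf.zero s hs, hg.zero s hs]⟩
  have h1 := hτ.map_cfcₙ_nonneg ha ht hd fun s => sub_nonneg.2 (h s)
  have h2 := congrArg Complex.re (hτ.map_cfcₙ_add ha ht hf hd)
  simp only [add_sub_cancel, Complex.add_re] at h2
  linarith

end Algebra

/-! ### A Dini-type lemma at extreme points -/

/-- A decreasing sequence of nonnegative continuous affine functions on a compact convex set that
tends to `0` at every extreme point becomes uniformly small. -/
theorem exists_forall_lt_of_tendsto_extremePoints {E : Type*} [AddCommGroup E] [Module ℝ E]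
    [TopologicalSpace E] [IsTopologicalAddGroup E] [ContinuousSMul ℝ E] [LocallyConvexSpace ℝ E]
    [T2Space E] {S : Set E} (hS : IsCompact S) (φ : ℕ → E →L[ℝ] ℝ)
    (hanti : ∀ x ∈ S, Antitone fun n => φ n x)
    (hext : ∀ x ∈ S.extremePoints ℝ, Tendsto (fun n => φ n x) atTop (𝓝 0)) {δ : ℝ} (hδ : 0 < δ) :
    ∃ n, ∀ x ∈ S, φ n x < δ := by
  by_contra! hcon
  have hmax : ∀ n, ∃ x ∈ S, ∀ y ∈ S, φ n y ≤ φ n x := fun n =>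
    hS.exists_isMaxOn ⟨_, (hcon n).choose_spec.1⟩ (φ n).continuous.continuousOn
  choose x hxS hx using hmax
  have hδx : ∀ n, δ ≤ φ n (x n) := fun n => by
    obtain ⟨y, hy, hy'⟩ := hcon n
    exact hy'.trans (hx n y hy)
  have hmono : Antitone fun n => φ n (x n) := fun m n hmn =>
    (hanti _ (hxS n) hmn).trans (hx m _ (hxS n))
  have hbdd : BddBelow (Set.range fun n => φ n (x n)) := ⟨δ, by rintro _ ⟨n, rfl⟩; exact hδx n⟩
  set α : ℝ := ⨅ n, φ n (x n) with hα
  have hlim : Tendsto (fun n => φ n (x n)) atTop (𝓝 α) := tendsto_atTop_ciInf hmono hbdd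
  have hαδ : δ ≤ α := le_ciInf hδx
  have hαx : ∀ n, α ≤ φ n (x n) := fun n => ciInf_le hbdd n
  -- `α` is the limit of the maxima. The intersection of the `K n` is a nonempty compact extreme
  -- subset of `S`, so by Krein–Milman it contains an extreme point of `S`, where the limit cannot
  -- be `0`.
  set K : ℕ → Set E := fun n => {y | y ∈ S ∧ α ≤ φ n y} with hK
  have hKclosed : ∀ n, IsCompact (K n) := fun n =>
    hS.inter_right (isClosed_le continuous_const (φ n).continuous)
  have hF : (⋂ n, K n).Nonempty :=
    IsCompact.nonempty_iInter_of_sequence_nonempty_isCompact_isClosed K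
      (fun n y hy => ⟨hy.1, hy.2.trans (hanti y hy.1 n.le_succ)⟩) (fun n => ⟨x n, hxS n, hαx n⟩)
      (hKclosed 0) (fun n => (hKclosed n).isClosed)
  have hFc : IsCompact (⋂ n, K n) :=
    (hKclosed 0).of_isClosed_subset (isClosed_iInter fun n => (hKclosed n).isClosed)
      (Set.iInter_subset _ 0)
  have hFext : IsExtreme ℝ S (⋂ n, K n) := by
    refine ⟨fun y hy => (Set.mem_iInter.1 hy 0).1, ?_⟩
    rintro y hy z hz w hw ⟨p, q, hp, hq, hpq, rfl⟩
    refine Set.mem_iInter.2 fun n => ⟨hy, ?_⟩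
    -- Bound `φ m z` by the maximum `φ m (x m)`, which tends to `α`; in the limit, `y` must take up
    -- its full share `p * α`.
    have h1 : ∀ᶠ m in atTop, α ≤ p * φ n y + q * φ m (x m) := by
      filter_upwards [eventually_ge_atTop n] with m hm
      have h2 := (Set.mem_iInter.1 hw m).2
      simp only [map_add, map_smul, smul_eq_mul] at h2
      have h3 : φ m y ≤ φ n y := hanti y hy hm
      have h4 := hx m z hz
      nlinarith
    have h5 : α ≤ p * φ n y + q * α :=
      ge_of_tendsto ((hlim.const_mul q).const_add (p * φ n y)) h1
    have h6 : p * α ≤ p * φ n y := by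
      have : p = 1 - q := by linarith
      nlinarith
    exact le_of_mul_le_mul_left h6 hp
  obtain ⟨w, hw⟩ := hFc.extremePoints_nonempty hF
  have hwS := hFext.extremePoints_subset_extremePoints hw
  have := ge_of_tendsto (hext w hwS)
    (Eventually.of_forall fun n => (Set.mem_iInter.1 hw.1 n).2)
  linarith

/-! ### Tents and cutoffs -/

/-- The tent function around `t` of slope `K`, truncated at `1`. -/
noncomputable def tent (t K s : ℝ) : ℝ := max 0 (min 1 (2 - K * |s - t|))

theorem tent_nonneg (t K s : ℝ) : 0 ≤ tent t K s := le_max_left _ _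

theorem tent_anti (t s : ℝ) : Antitone fun K => tent t K s := fun K L h => by
  have : K * |s - t| ≤ L * |s - t| := mul_le_mul_of_nonneg_right h (abs_nonneg _)
  exact max_le_max le_rfl (min_le_min le_rfl (by linarith))

theorem tent_vanishesBelow {t K : ℝ} (ht : 0 < t) (hK : 4 / t ≤ K) :
    VanishesBelow (t / 2) (tent t K) := by
  refine ⟨by unfold tent; fun_prop, fun s hs => ?_⟩
  have h1 : 4 ≤ K * t := (div_le_iff₀ ht).1 hK
  have hK0 : 0 < K := (by positivity : 0 < 4 / t).trans_le hK
  have h2 : t / 2 ≤ |s - t| := by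
    rw [abs_sub_comm]
    exact le_trans (by linarith) (le_abs_self _)
  refine max_eq_left (min_le_of_right_le ?_)
  nlinarith

/-- The truncation of `s ↦ (s - t)_+` by `cutoff ε`. -/
theorem cutoff_comp_vanishesBelow (t ε : ℝ) :
    VanishesBelow t fun s => cutoff ε (max 0 (s - t)) := by
  refine ⟨by unfold cutoff; fun_prop, fun s hs => ?_⟩
  rw [max_eq_left (by linarith)]
  simp [cutoff]

theorem cutoff_nonneg (ε s : ℝ) : 0 ≤ cutoff ε s := le_min zero_le_one (le_max_left _ _)

theorem cutoff_le_one (ε s : ℝ) : cutoff ε s ≤ 1 := min_le_left _ _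

theorem cutoff_eq_one {ε s : ℝ} (hε : 0 < ε) (hs : ε ≤ s) : cutoff ε s = 1 := by
  refine min_eq_left (le_max_of_le_right ?_)
  have : 1 ≤ s / ε := (one_le_div hε).2 hs
  rw [mul_div_assoc]
  linarith

theorem cutoff_vanishesBelow {ε : ℝ} (hε : 0 < ε) : VanishesBelow (ε / 2) (cutoff ε) := by
  refine ⟨by unfold cutoff; fun_prop, fun s hs => ?_⟩
  have : s / ε ≤ 1 / 2 := by
    rw [div_le_iff₀ hε]
    linarith
  rw [cutoff, mul_div_assoc, max_eq_left (by linarith)]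
  simp

theorem VanishesBelow.mono {t t' : ℝ} (h : t' ≤ t) {f : ℝ → ℝ} (hf : VanishesBelow t f) :
    VanishesBelow t' f := ⟨hf.cont, fun s hs => hf.zero s (hs.trans h)⟩

theorem VanishesBelow.add {t : ℝ} {f g : ℝ → ℝ} (hf : VanishesBelow t f)
    (hg : VanishesBelow t g) : VanishesBelow t fun s => f s + g s :=
  ⟨hf.cont.add hg.cont, fun s hs => by simp [hf.zero s hs, hg.zero s hs]⟩

/-! ### Spectral mass, atoms and oscillation -/

section Level

variable {B : Type u} [NonUnitalCStarAlgebra B]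

/-- The mass that `τ` gives to the part of the spectrum of `a` above `t`. -/
noncomputable def levelMass (τ : B → ℂ) (a : B) (t : ℝ) : ℝ≥0∞ :=
  ⨆ (f : ℝ → ℝ) (_ : VanishesBelow t f ∧ ∀ s, 0 ≤ f s ∧ f s ≤ 1),
    ENNReal.ofReal (τ (cfcₙ f a)).re

theorem levelMass_anti (τ : B → ℂ) (a : B) : Antitone (levelMass τ a) := fun _ _ h =>
  iSup₂_le fun f hf => le_iSup₂_of_le f ⟨hf.1.mono h, hf.2⟩ le_rfl

theorem IsQuasitrace.levelMass_lt_top {τ : B → ℂ} (hτ : IsQuasitrace τ) {a : B}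
    (ha : IsSelfAdjoint a) {t : ℝ} (ht : 0 < t) : levelMass τ a t < ∞ := by
  refine lt_of_le_of_lt (iSup₂_le fun f hf => ENNReal.ofReal_le_ofReal ?_)
    (ENNReal.ofReal_lt_top (r := (τ (cfcₙ (cutoff t) a)).re))
  refine hτ.map_cfcₙ_mono ha (half_pos ht) (hf.1.mono (by linarith)) (cutoff_vanishesBelow ht) ?_
  intro s
  rcases le_or_gt s t with h | h
  · rw [hf.1.zero s h]
    exact cutoff_nonneg _ _
  · rw [cutoff_eq_one ht h.le]
    exact (hf.2 s).2

/-- The tent lives within `2 / K` of `t`, disjointly from any competitor above `t + 2 / K`, so their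
sum is at most `1` and lies below a ramp rising between `t - 3 / K` and `t - 2 / K`. Hence the drop
of the level mass across `t` controls the tent. -/
theorem IsQuasitrace.tent_add_levelMass_le {τ : B → ℂ} (hτ : IsQuasitrace τ) {a : B}
    (ha : IsSelfAdjoint a) {t K : ℝ} (ht : 0 < t) (hK : 4 / t ≤ K) :
    ENNReal.ofReal (τ (cfcₙ (tent t K) a)).re + levelMass τ a (t + 2 / K) ≤
      levelMass τ a (t - 3 / K) := by
  have h1 : 4 ≤ K * t := (div_le_iff₀ ht).1 hK
  have hK0 : 0 < K := (by positivity : 0 < 4 / t).trans_le hK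
  have hpos : 0 < t - 3 / K := by
    rw [sub_pos, div_lt_iff₀ hK0]
    linarith
  set R : ℝ → ℝ := fun s => cutoff (1 / K) (max 0 (s - (t - 3 / K))) with hR
  have hRv : VanishesBelow (t - 3 / K) R := cutoff_comp_vanishesBelow _ _
  have htent : VanishesBelow (t - 3 / K) (tent t K) := by
    refine ⟨(tent_vanishesBelow ht hK).cont, fun s hs => ?_⟩
    have h2 : 3 / K ≤ |s - t| := by
      rw [abs_sub_comm]
      exact le_trans (by linarith) (le_abs_self _)
    refine max_eq_left (min_le_of_right_le ?_)
    have := (div_le_iff₀' hK0).1 h2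
    linarith
  refine le_trans ?_ (le_iSup₂ (f := fun (f : ℝ → ℝ)
    (_ : VanishesBelow (t - 3 / K) f ∧ ∀ s, 0 ≤ f s ∧ f s ≤ 1) => ENNReal.ofReal (τ (cfcₙ f a)).re) R
    ⟨hRv, fun s => ⟨cutoff_nonneg _ _, cutoff_le_one _ _⟩⟩)
  have h0 := hτ.map_cfcₙ_nonneg ha (half_pos ht) (tent_vanishesBelow ht hK) (tent_nonneg t K)
  rw [levelMass]
  have : Nonempty {f : ℝ → ℝ // VanishesBelow (t + 2 / K) f ∧ ∀ s, 0 ≤ f s ∧ f s ≤ 1} :=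
    ⟨⟨fun _ => 0, ⟨continuous_const, fun _ _ => rfl⟩, fun _ => ⟨le_rfl, zero_le_one⟩⟩⟩
  rw [iSup_subtype', ENNReal.add_iSup]
  refine iSup_le ?_
  rintro ⟨f, hf, hf1⟩
  have hfv : VanishesBelow (t - 3 / K) f := hf.mono (by
    have : 0 < 2 / K := by positivity
    have : 0 < 3 / K := by positivity
    linarith)
  have key : (τ (cfcₙ (tent t K) a)).re + (τ (cfcₙ f a)).re ≤ (τ (cfcₙ R a)).re := by
    rw [← Complex.add_re, ← hτ.map_cfcₙ_add ha hpos htent hfv]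
    refine hτ.map_cfcₙ_mono ha hpos (htent.add hfv) hRv fun s => ?_
    rcases le_or_gt s (t + 2 / K) with h | h
    · rw [hf.zero s h, add_zero]
      rcases le_or_gt s (t - 2 / K) with h' | h'
      · have h2 : 2 / K ≤ |s - t| := by
          rw [abs_sub_comm]
          exact le_trans (by linarith) (le_abs_self _)
        have h3 := (div_le_iff₀' hK0).1 h2
        have : tent t K s = 0 := max_eq_left (min_le_of_right_le (by linarith))
        rw [this]
        exact cutoff_nonneg _ _
      · have : R s = 1 := cutoff_eq_one (by positivity) (le_max_of_le_right (by
          have : 3 / K = 2 / K + 1 / K := by ring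
          linarith))
        rw [this]
        exact max_le zero_le_one (min_le_left _ _)
    · have h2 : 2 / K ≤ |s - t| := le_trans (by linarith) (le_abs_self _)
      have h3 := (div_le_iff₀' hK0).1 h2
      have h4 : tent t K s = 0 := max_eq_left (min_le_of_right_le (by linarith))
      have : R s = 1 := cutoff_eq_one (by positivity) (le_max_of_le_right (by
        have : 3 / K = 2 / K + 1 / K := by ring
        have : 0 < 2 / K := by positivity
        linarith))
      rw [h4, zero_add, this]
      exact (hf1 s).2
  refine le_trans ?_ (ENNReal.ofReal_le_ofReal key)
  rw [ENNReal.ofReal_add h0 (hτ.map_cfcₙ_nonneg ha hpos hfv fun s => (hf1 s).1)]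

/-- At a continuity point of `levelMass τ a`, the quasitrace `τ` has no atom. -/
theorem IsQuasitrace.tendsto_tent {τ : B → ℂ} (hτ : IsQuasitrace τ) {a : B}
    (ha : IsSelfAdjoint a) {t : ℝ} (ht : 0 < t) (hc : ContinuousAt (levelMass τ a) t) :
    Tendsto (fun n : ℕ => (τ (cfcₙ (tent t (n + 4 / t)) a)).re) atTop (𝓝 0) := by
  have hK : Tendsto (fun n : ℕ => (n : ℝ) + 4 / t) atTop atTop :=
    tendsto_atTop_add_const_right _ _ tendsto_natCast_atTop_atTop
  have h4 : ∀ n : ℕ, 4 / t ≤ (n : ℝ) + 4 / t := fun n => by simp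
  have hl : ∀ c : ℝ, Tendsto (fun n : ℕ => c / ((n : ℝ) + 4 / t)) atTop (𝓝 0) := fun c =>
    hK.const_div_atTop c
  have h1 : Tendsto (fun n : ℕ => levelMass τ a (t + 2 / ((n : ℝ) + 4 / t))) atTop
      (𝓝 (levelMass τ a t)) :=
    hc.tendsto.comp (by simpa using (hl 2).const_add t)
  have h2 : Tendsto (fun n : ℕ => levelMass τ a (t - 3 / ((n : ℝ) + 4 / t))) atTop
      (𝓝 (levelMass τ a t)) :=
    hc.tendsto.comp (by simpa using (hl 3).const_sub t)
  have hfin := hτ.levelMass_lt_top ha ht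
  have h3 := ENNReal.Tendsto.sub h2 h1 (Or.inl hfin.ne)
  rw [tsub_self] at h3
  have h5 : Tendsto (fun n : ℕ => ENNReal.ofReal (τ (cfcₙ (tent t (n + 4 / t)) a)).re) atTop
      (𝓝 0) := by
    refine tendsto_of_tendsto_of_tendsto_of_le_of_le tendsto_const_nhds h3 (fun _ => zero_le)
      fun n => ?_
    refine ENNReal.le_sub_of_add_le_right ?_ (hτ.tent_add_levelMass_le ha ht (h4 n))
    refine (hτ.levelMass_lt_top ha ?_).ne
    have : 0 < 4 / t := by positivity
    positivity
  have h6 := (ENNReal.tendsto_toReal ENNReal.zero_ne_top).comp h5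
  simp only [ENNReal.toReal_zero] at h6
  refine h6.congr fun n => ENNReal.toReal_ofReal ?_
  exact hτ.map_cfcₙ_nonneg ha (half_pos ht) (tent_vanishesBelow ht (h4 n)) (tent_nonneg _ _)

/-- For all but countably many `t`, the oscillation of `(a - t)_+` over a compact convex set with
countably many extreme points is witnessed to be zero by contractions of `Her ((a - t)_+)`. -/
theorem exists_dimFun_le [PartialOrder B] [StarOrderedRing B] {S : Set (B → ℂ)}
    (hS : ∀ τ ∈ S, IsQuasitrace τ) (hcomp : IsCompact S)
    (hcount : (S.extremePoints ℝ).Countable) {a : B} (ha : IsSelfAdjoint a) {r : ℝ} (hr : 0 < r) :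
    ∃ t ∈ Set.Ioo 0 r, ∀ δ : ℝ, 0 < δ →
      ∃ c ∈ Her (cfcₙ (fun s => max 0 (s - t)) a), 0 ≤ c ∧ ‖c‖ ≤ 1 ∧ ∀ τ ∈ S,
        0 ≤ (τ c).re ∧
        dimFun τ (cfcₙ (fun s => max 0 (s - t)) a) ≤ ENNReal.ofReal ((τ c).re + δ) := by
  -- Monotone functions have countably many discontinuities; this is where countability of the
  -- extreme boundary enters.
  have hbad : (⋃ τ ∈ S.extremePoints ℝ, {t | ¬ ContinuousAt (levelMass τ a) t}).Countable :=
    hcount.biUnion fun τ _ => (levelMass_anti τ a).countable_not_continuousAt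
  obtain ⟨t, htbad, ht⟩ := (hbad.dense_compl ℝ).exists_between hr
  refine ⟨t, ht, fun δ hδ => ?_⟩
  have ht0 : 0 < t := ht.1
  have h4 : ∀ n : ℕ, 4 / t ≤ (n : ℝ) + 4 / t := fun n => by simp
  -- A quasitrace need not be linear on `B`, but evaluation at a fixed element is linear and
  -- continuous in `τ`.
  obtain ⟨n, hn⟩ := exists_forall_lt_of_tendsto_extremePoints hcomp
    (fun n : ℕ => (Complex.reCLM).comp (ContinuousLinearMap.proj (R := ℝ) (φ := fun _ : B => ℂ)
      (cfcₙ (tent t (n + 4 / t)) a)))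
    (fun τ hτ m n hmn => (hS τ hτ).map_cfcₙ_mono ha (half_pos ht0)
      (tent_vanishesBelow ht0 (h4 n)) (tent_vanishesBelow ht0 (h4 m))
      fun s => tent_anti t s (by gcongr))
    (fun τ hτ => (hS τ (extremePoints_subset hτ)).tendsto_tent ha ht0 (by
      by_contra hcon
      exact htbad (Set.mem_biUnion hτ hcon))) hδ
  have hK0 : 0 < (n : ℝ) + 4 / t := by positivity
  set K : ℝ := (n : ℝ) + 4 / t with hK
  set e : B := cfcₙ (fun s => max 0 (s - t)) a with he
  have hesa : IsSelfAdjoint e := cfcₙ_predicate _ a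
  have hcomp : ∀ ε > 0, cfcₙ (cutoff ε) e = cfcₙ (fun s => cutoff ε (max 0 (s - t))) a := by
    intro ε hε
    have h1 := cutoff_vanishesBelow hε
    rw [he, ← cfcₙ_comp' (cutoff ε) (fun s => max 0 (s - t)) a h1.cont.continuousOn
      (h1.apply_zero (half_pos hε)) (by fun_prop) (by simp [ht0.le])]
  have hη : 0 < 1 / K := by positivity
  refine ⟨cfcₙ (cutoff (1 / K)) e, (cutoff_vanishesBelow hη).cfcₙ_mem_Her (half_pos hη) hesa,
    cfcₙ_nonneg fun s _ => cutoff_nonneg _ _, norm_cfcₙ_le fun s _ => ?_, fun τ hτ => ?_⟩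
  · rw [Real.norm_of_nonneg (cutoff_nonneg _ _)]
    exact cutoff_le_one _ _
  have hq := hS τ hτ
  have hv : ∀ ε, VanishesBelow (t / 2) fun s => cutoff ε (max 0 (s - t)) := fun ε =>
    (cutoff_comp_vanishesBelow t ε).mono (by linarith)
  rw [hcomp _ hη]
  refine ⟨hq.map_cfcₙ_nonneg ha (half_pos ht0) (hv _) fun s => cutoff_nonneg _ _, ?_⟩
  refine iSup₂_le fun ε hε => ENNReal.ofReal_le_ofReal ?_
  rw [hcomp ε hε]
  refine le_trans ?_ (add_le_add_right (hn τ hτ).le _)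
  have htv := tent_vanishesBelow ht0 (h4 n)
  have hadd := congrArg Complex.re (hq.map_cfcₙ_add ha (half_pos ht0) (hv (1 / K)) htv)
  rw [Complex.add_re] at hadd
  refine le_trans ?_ hadd.le
  -- Pointwise, the tent is `1` on `(t, t + 1 / K]` and the cutoff at `1 / K` is `1` beyond, so
  -- their sum dominates every cutoff, whatever `ε`.
  refine hq.map_cfcₙ_mono ha (half_pos ht0) (hv ε) ((hv _).add htv) fun s => ?_
  rcases le_or_gt s t with h | h
  · rw [(cutoff_comp_vanishesBelow t ε).zero s h]
    exact add_nonneg (cutoff_nonneg _ _) (tent_nonneg _ _ _)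
  rcases le_or_gt s (t + 1 / K) with h' | h'
  · have h1 : |s - t| ≤ 1 / K := by
      rw [abs_of_pos (sub_pos.2 h)]
      linarith
    have h2 := (le_div_iff₀' hK0).1 h1
    have : tent t K s = 1 := by
      rw [tent, min_eq_left (by linarith), max_eq_right zero_le_one]
    rw [this]
    linarith [cutoff_le_one ε (max 0 (s - t)), cutoff_nonneg (1 / K) (max 0 (s - t))]
  · rw [cutoff_eq_one hη (le_max_of_le_right (by linarith) : 1 / K ≤ max 0 (s - t))]
    linarith [cutoff_le_one ε (max 0 (s - t)), tent_nonneg t K s]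

theorem dimFun_smul_le (r : ℝ) (hr : 0 ≤ r) (τ : B → ℂ) (a : B) :
    dimFun (r • τ) a ≤ ENNReal.ofReal r * dimFun τ a := by
  refine iSup₂_le fun ε hε => ?_
  have : ((r • τ) (cfcₙ (cutoff ε) a)).re = r * (τ (cfcₙ (cutoff ε) a)).re := by simp
  rw [this, ENNReal.ofReal_mul hr]
  gcongr
  exact le_iSup₂ (f := fun (ε : ℝ) (_ : 0 < ε) => ENNReal.ofReal (τ (cfcₙ (cutoff ε) a)).re) ε hε

/-- The norm approximate oscillation vanishes on every set of bounded multiples of members of a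
compact set of quasitraces with countably many extreme points. -/
theorem normApproxOsc_eq_zero [PartialOrder B] [StarOrderedRing B] {S S' : Set (B → ℂ)}
    (hS : ∀ τ ∈ S, IsQuasitrace τ) (hcomp : IsCompact S)
    (hcount : (S.extremePoints ℝ).Countable) {M : ℝ}
    (hS' : ∀ τ ∈ S', ∃ r : ℝ, 0 ≤ r ∧ r ≤ M ∧ ∃ s ∈ S, τ = r • s) {a : B} (ha : 0 ≤ a) :
    normApproxOsc S' a = 0 := by
  have hsa : IsSelfAdjoint a := IsSelfAdjoint.of_nonneg ha
  refine nonpos_iff_eq_zero.1 (ENNReal.le_of_forall_pos_le_add fun ε hε _ => ?_)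
  rw [zero_add]
  obtain ⟨t, ht, h⟩ := exists_dimFun_le hS hcomp hcount hsa (r := ε) hε
  have hv : VanishesBelow t fun s => max 0 (s - t) :=
    ⟨by fun_prop, fun s hs => max_eq_left (by linarith)⟩
  set e : B := cfcₙ (fun s => max 0 (s - t)) a with he
  have hosc : osc S' e = 0 := by
    refine nonpos_iff_eq_zero.1 (ENNReal.le_of_forall_pos_le_add fun δ hδ _ => ?_)
    rw [zero_add]
    -- Passing from `s` to `r • s` multiplies the error by `r ≤ M`.
    obtain ⟨c, hc, hc0, hc1, hcS⟩ := h (δ / (|M| + 1)) (by positivity)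
    refine iInf₂_le_of_le c ⟨hc, hc0, hc1⟩ (iSup₂_le fun τ hτ => ?_)
    obtain ⟨r, hr, hrM, s, hs, rfl⟩ := hS' τ hτ
    obtain ⟨h1, h2⟩ := hcS s hs
    have h3 : ((r • s) c).re = r * (s c).re := by simp
    rw [h3, tsub_le_iff_right]
    refine (dimFun_smul_le r hr s e).trans ?_
    have h4 : r * ((s c).re + δ / (|M| + 1)) ≤ δ + r * (s c).re := by
      have h5 : r * (δ / (|M| + 1)) ≤ δ := by
        rw [mul_div_assoc', div_le_iff₀ (by positivity), mul_comm]
        have := le_abs_self M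
        exact mul_le_mul_of_nonneg_left (by linarith) δ.2
      linarith
    calc ENNReal.ofReal r * dimFun s e
        ≤ ENNReal.ofReal r * ENNReal.ofReal ((s c).re + δ / (|M| + 1)) := by gcongr
      _ = ENNReal.ofReal (r * ((s c).re + δ / (|M| + 1))) := (ENNReal.ofReal_mul hr).symm
      _ ≤ ENNReal.ofReal (δ + r * (s c).re) := ENNReal.ofReal_le_ofReal h4
      _ = δ + ENNReal.ofReal (r * (s c).re) := by
        rw [ENNReal.ofReal_add δ.coe_nonneg (mul_nonneg hr h1), ENNReal.ofReal_coe_nnreal]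
  -- The oscillation of `e` is exactly zero, so a constant sequence suffices.
  refine iInf₂_le_of_le (fun _ => e) ⟨fun _ => ⟨hv.cfcₙ_mem_Her ht.1 hsa,
    hv.cfcₙ_mem_Ped ht.1 hsa, cfcₙ_nonneg fun s _ => le_max_left _ _⟩, ⟨‖e‖, fun _ => le_rfl⟩, by
      simp [hosc]⟩ (iSup_le fun _ => ?_)
  have hdiff : a - e = cfcₙ (fun s => s - max 0 (s - t)) a := by
    rw [cfcₙ_sub (fun s => s) (fun s => max 0 (s - t)) (a := a) (hf := by fun_prop) (hf0 := rfl)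
      (hg := by fun_prop) (hg0 := by simp [ht.1.le]), cfcₙ_id' ℝ a]
  have hnorm : ‖a - e‖ ≤ t := by
    rw [hdiff]
    refine norm_cfcₙ_le fun s hs => ?_
    have hs0 : 0 ≤ s := quasispectrum_nonneg_of_nonneg a ha s hs
    rw [Real.norm_eq_abs, abs_le]
    have := ht.1
    constructor <;> rcases max_cases 0 (s - t) with h | h <;> linarith
  rw [← ofReal_norm, ← ENNReal.ofReal_coe_nnreal]
  exact ENNReal.ofReal_le_ofReal (hnorm.trans ht.2.le)

end Level

/-! ### Comparison of compact bases -/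

section Cone

variable {A : Type u} [NonUnitalCStarAlgebra A] [PartialOrder A] [StarOrderedRing A]

/-- The members of a compact base are bounded multiples of members of `T_b`. -/
theorem IsCompactBase.exists_bound {b : A} (hb : IsCompactBase A (Tslice b))
    {S : Set (Stab A → ℂ)} (hS : IsCompactBase A S) :
    ∃ M : ℝ, ∀ τ ∈ S, ∃ r : ℝ, 0 ≤ r ∧ r ≤ M ∧ ∃ s ∈ Tslice b, τ = r • s := by
  -- If `τ = r • s` with `s ∈ T_b`, then `r` is the value of `τ` at `b`, a continuous function of
  -- `τ`.
  obtain ⟨M, hM⟩ := hS.compact.bddAbove_image (f := fun τ : Stab A → ℂ => (τ (corner b)).re)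
    (Complex.continuous_re.comp (continuous_apply _)).continuousOn
  refine ⟨M, fun τ hτ => ?_⟩
  obtain ⟨r, hr, s, hs, rfl⟩ := hb.spans τ (hS.subset hτ).1
  refine ⟨r, hr, ?_, s, hs, rfl⟩
  have := hM (Set.mem_image_of_mem _ hτ)
  simpa [hs.2] using this

end Cone

end QuasiTr

theorem mainTheorem10 {A : Type*} [NonUnitalCStarAlgebra A] [PartialOrder A] [StarOrderedRing A]
    (b : A) (hb_ped : b ∈ QuasiTr.Ped A) (hb_nonneg : 0 ≤ b) (hb_ne : b ≠ 0)
    (hbase : QuasiTr.IsCompactBase A (QuasiTr.Tslice b))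
    (hcount : (Set.extremePoints ℝ (QuasiTr.Tslice b)).Countable) :
    (∀ a : QuasiTr.Stab A, a ∈ QuasiTr.Ped (QuasiTr.Stab A) → 0 ≤ a →
      QuasiTr.normApproxOsc (QuasiTr.Tslice b) a = 0) ∧
    QuasiTr.NormApproxOscZero A := by
  have hq : ∀ τ ∈ QuasiTr.Tslice b, QuasiTr.IsQuasitrace τ := fun τ hτ => hτ.1.1
  have key : ∀ S, QuasiTr.IsCompactBase A S → QuasiTr.NormApproxOscZeroOn A S := by
    intro S hS a _ ha
    obtain ⟨M, hM⟩ := hbase.exists_bound hS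
    exact QuasiTr.normApproxOsc_eq_zero hq hbase.compact hcount hM ha
  exact ⟨key _ hbase, ⟨_, hbase⟩, key⟩
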